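/- Let $k\ge 2$ be an integer. For each odd prime $p$ coprime to $k$ put $F_p(z)=\prod_{n\ge 0}\Phi_p\bigl(z^{k^n}\bigr)$, where $\Phi_p$ is the $p$-th cyclotomic polynomial. Then each of these products converges for $|z|<1$ and defines a function that is equal on the open unit disc to the sum of its Taylor series at $0$, and the infinite family $(F_p)_p$, indexed by all odd primes $p$ coprime to $k$, is algebraically independent over the field $\mathbb{C}(z)$ of rational functions. Here the $F_p$ are regarded, through their Taylor series at $0$, as elements of the field $\mathbb{C}((z))$ of formal Laurent series, which contains $\mathbb{C}(z)$ by expansion at $0$. -/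

import Mathlib

-- makes the standard `ℂ(z)`-algebra structure on `ℂ((z))` (expansion at `0`) available
open scoped RatFunc

noncomputable section

/-- The function `F_p(z) = ∏_{n ≥ 0} Φ_p(z ^ (k ^ n))`, where `Φ_p` is the `p`-th cyclotomic
polynomial. For `k ≥ 2` it is meant on the open unit disc, where the product converges. -/
def cyclotomicProduct (k p : ℕ) (z : ℂ) : ℂ :=
  ∏' n : ℕ, (Polynomial.cyclotomic p ℂ).eval (z ^ (k ^ n))

/-- The Taylor series at `0` of a function `f : ℂ → ℂ`, as a formal power series. -/
def taylorSeriesAtZero (f : ℂ → ℂ) : PowerSeries ℂ :=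
  PowerSeries.mk fun m => iteratedDeriv m f 0 / (m.factorial : ℂ)

/-- The element of the field `ℂ((z))` of formal Laurent series given by the Taylor series of
`F_p` at `0`. -/
def cyclotomicProductSeries (k p : ℕ) : LaurentSeries ℂ :=
  (taylorSeriesAtZero (cyclotomicProduct k p) : LaurentSeries ℂ)

end

open Polynomial

/-! ### Linear independence of solutions of semilinear equations -/

/-! Each series satisfies F_p(z) = Φ_p(z) F_p(z^k), so a monomial F^s satisfies the same kind of
equation with factor Φ^s = ∏ Φ_p^(s_p). Algebraic independence is linear independence of these
monomials over ℂ[z]. Comparing a minimal linear relation with its image under z ↦ z^k gives r = P/Q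
≠ 0 with r(z^k)/r(z) = Φ^s/Φ^t (`linearIndependent_of_eq_smul_semilinear`). Then s = t
(`eq_of_cyclotomic_prod_mul_expand`): at a primitive p-th root of unity, passing from ζ to ζ^k
changes the order of r by s_p - t_p, but ζ returns to itself after finitely many steps since p is
coprime to k. -/

/-- Nonzero solutions `m i` of the equations `m i = a i • τ (m i)`, with `τ` semilinear with respect
to an endomorphism `σ`, are linearly independent as soon as the coefficients `a i` are
pairwise inequivalent modulo the elements `σ P / P`. -/
theorem linearIndependent_of_eq_smul_semilinear {R M ι : Type*} [CommRing R] [IsDomain R]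
    [AddCommGroup M] [Module R M] [Module.IsTorsionFree R M] {σ : R →+* R}
    (τ : M →ₛₗ[σ] M) {m : ι → M} {a : ι → R}
    (hm : ∀ i, m i ≠ 0) (ha : ∀ i, a i ≠ 0) (h : ∀ i, m i = a i • τ (m i))
    (hind : ∀ i j, ∀ P Q : R, P ≠ 0 → Q ≠ 0 → Q * σ P * a j = P * σ Q * a i → i = j) :
    LinearIndependent R m := by
  classical
  rw [linearIndependent_iff']
  intro s
  induction s using Finset.strongInduction with
  | H s ih =>
    intro g hg
    by_contra! hne
    obtain ⟨i₀, hi₀, hg₀⟩ := hne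
    -- Apply `τ` to the relation and multiply by all the `a j`: this clears the denominators in `τ
    -- (m i) = m i / a i`.
    have hτ : ∑ i ∈ s, (σ (g i) * ∏ j ∈ s.erase i, a j) • m i = 0 := by
      have : ∑ i ∈ s, (σ (g i) * ∏ j ∈ s.erase i, a j) • m i
          = (∏ j ∈ s, a j) • τ (∑ i ∈ s, g i • m i) := by
        rw [map_sum, Finset.smul_sum]
        refine Finset.sum_congr rfl fun i hi => ?_
        rw [map_smulₛₗ, smul_smul]
        nth_rewrite 1 [h i]
        rw [smul_smul, ← Finset.mul_prod_erase s a hi]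
        congr 1
        ring
      rw [this, hg, map_zero, smul_zero]
    -- Cross-multiplying the two relations cancels the `i₀` term, so the induction hypothesis
    -- applies.
    have hcomb : ∑ i ∈ s, (g i₀ * (σ (g i) * ∏ j ∈ s.erase i, a j)
        - (σ (g i₀) * ∏ j ∈ s.erase i₀, a j) * g i) • m i = 0 := by
      simp only [sub_smul, mul_smul, Finset.sum_sub_distrib, ← Finset.smul_sum]
      simp only [← mul_smul, hτ, hg]
      simp
    rw [← Finset.add_sum_erase s _ hi₀, mul_comm (g i₀), sub_self, zero_smul, zero_add] at hcomb
    have hzero := ih _ (Finset.erase_ssubset hi₀) _ hcomb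
    have huniq : ∀ i ∈ s, g i ≠ 0 → i = i₀ := by
      intro i hi hgi
      by_contra hii
      refine hii (hind i i₀ (g i) (g i₀) hgi hg₀ ?_)
      have h0 := sub_eq_zero.1 (hzero i (Finset.mem_erase.2 ⟨hii, hi⟩))
      have hP : (∏ j ∈ s, a j) ≠ 0 := Finset.prod_ne_zero_iff.2 fun j _ => ha j
      refine mul_right_cancel₀ hP ?_
      calc g i₀ * σ (g i) * a i₀ * ∏ j ∈ s, a j
          = (g i₀ * (σ (g i) * ∏ j ∈ s.erase i, a j)) * (a i * a i₀) := by
            rw [← Finset.mul_prod_erase s a hi]; ring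
        _ = ((σ (g i₀) * ∏ j ∈ s.erase i₀, a j) * g i) * (a i * a i₀) := by rw [h0]
        _ = g i * σ (g i₀) * a i * ∏ j ∈ s, a j := by
            rw [← Finset.mul_prod_erase s a hi₀]; ring
    rw [Finset.sum_eq_single_of_mem i₀ hi₀ fun i hi hii => by
      rw [not_not.1 (mt (huniq i hi) hii), zero_smul]] at hg
    exact (smul_ne_zero hg₀ (hm i₀)) hg

/-! ### Root multiplicities -/

theorem Polynomial.rootMultiplicity_prod_of_ne_zero {R ι : Type*} [CommRing R] [IsDomain R]
    (s : Finset ι) (f : ι → R[X]) (hf : ∀ i ∈ s, f i ≠ 0) (x : R) :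
    (∏ i ∈ s, f i).rootMultiplicity x = ∑ i ∈ s, (f i).rootMultiplicity x := by
  classical
  induction s using Finset.induction_on with
  | empty => simp
  | insert i s hi ih =>
    have hs := fun j hj => hf j (Finset.mem_insert_of_mem hj)
    rw [Finset.prod_insert hi, Finset.sum_insert hi, rootMultiplicity_mul, ih hs]
    exact mul_ne_zero (hf i (Finset.mem_insert_self i s)) (Finset.prod_ne_zero_iff.2 hs)

theorem Polynomial.rootMultiplicity_pow_of_ne_zero {R : Type*} [CommRing R] [IsDomain R]
    {f : R[X]} (hf : f ≠ 0) (x : R) (n : ℕ) :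
    (f ^ n).rootMultiplicity x = n * f.rootMultiplicity x := by
  simpa using rootMultiplicity_prod_of_ne_zero (Finset.range n) (fun _ => f) (fun _ _ => hf) x

/-- In characteristic zero the substitution `X ↦ X ^ k` is unramified away from `0`. -/
theorem Polynomial.rootMultiplicity_expand_of_charZero {K : Type*} [Field K] [CharZero K] {k : ℕ}
    (hk : 0 < k) {α : K} (hα : α ≠ 0) {P : K[X]} (hP : P ≠ 0) :
    (expand K k P).rootMultiplicity α = P.rootMultiplicity (α ^ k) := by
  obtain ⟨Q, hPQ, hQ⟩ := exists_eq_pow_rootMultiplicity_mul_and_not_dvd P hP (α ^ k)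
  set n := P.rootMultiplicity (α ^ k)
  have hQ' : (expand K k Q).rootMultiplicity α = 0 := by
    refine rootMultiplicity_eq_zero fun hroot => hQ (dvd_iff_isRoot.2 ?_)
    rwa [IsRoot, expand_eval] at hroot
  have hlin : (X ^ k - C (α ^ k) : K[X]).rootMultiplicity α = 1 := by
    have hsep : (X ^ k - C (α ^ k) : K[X]).Separable :=
      separable_X_pow_sub_C _ (by exact_mod_cast hk.ne') (pow_ne_zero k hα)
    refine le_antisymm (rootMultiplicity_le_one_of_separable hsep α) ?_
    exact (rootMultiplicity_pos hsep.ne_zero).2 (by simp)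
  have hexp : expand K k P = (X ^ k - C (α ^ k)) ^ n * expand K k Q := by
    rw [hPQ]
    simp [n]
  have hne : expand K k P ≠ 0 := (expand_ne_zero hk).2 hP
  rw [hexp] at hne ⊢
  rw [rootMultiplicity_mul hne, hQ', rootMultiplicity_pow_of_ne_zero (X_pow_sub_C_ne_zero hk _),
    hlin, mul_one, add_zero]

theorem Polynomial.rootMultiplicity_cyclotomic {K : Type*} [Field K] [CharZero K] {p q : ℕ}
    (hq : 0 < q) {ζ : K} (hζ : IsPrimitiveRoot ζ p) :
    (cyclotomic q K).rootMultiplicity ζ = if q = p then 1 else 0 := by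
  have : NeZero (q : K) := ⟨by exact_mod_cast hq.ne'⟩
  split_ifs with h
  · subst h
    refine le_antisymm (rootMultiplicity_le_one_of_separable (separable_cyclotomic q K) ζ) ?_
    exact (rootMultiplicity_pos (cyclotomic_ne_zero q K)).2 (isRoot_cyclotomic_iff.2 hζ)
  · refine rootMultiplicity_eq_zero fun hroot => h ?_
    exact (isRoot_cyclotomic_iff.1 hroot).unique hζ

/-- A product of cyclotomic polynomials `Φ_p`, with `p` coprime to `k`, is determined by its class
modulo the rational functions `r (X ^ k) / r (X)`. -/
theorem eq_of_cyclotomic_prod_mul_expand {S : ℕ → Prop} {k : ℕ} (hk : 0 < k)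
    (hS : ∀ p, S p → 0 < p ∧ p.Coprime k) (s t : {p // S p} →₀ ℕ) {P Q : ℂ[X]}
    (hP : P ≠ 0) (hQ : Q ≠ 0)
    (h : Q * expand ℂ k P * (t.prod fun p e => cyclotomic p ℂ ^ e)
      = P * expand ℂ k Q * (s.prod fun p e => cyclotomic p ℂ ^ e)) : s = t := by
  classical
  ext p
  obtain ⟨hp0, hpk⟩ := hS p p.2
  have hprod : ∀ u : {p // S p} →₀ ℕ, (u.prod fun p e => cyclotomic (p : ℕ) ℂ ^ e) ≠ 0 := fun u =>
    Finset.prod_ne_zero_iff.2 fun q _ => pow_ne_zero _ (cyclotomic_ne_zero q ℂ)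
  have hmult : ∀ (u : {p // S p} →₀ ℕ) (ζ : ℂ), IsPrimitiveRoot ζ p →
      (u.prod fun p e => cyclotomic (p : ℕ) ℂ ^ e).rootMultiplicity ζ = u p := by
    intro u ζ hζ
    rw [Finsupp.prod, rootMultiplicity_prod_of_ne_zero u.support
      (fun q => cyclotomic (q : ℕ) ℂ ^ u q) fun q _ => pow_ne_zero _ (cyclotomic_ne_zero q ℂ)]
    have hq : ∀ q : {p // S p}, (cyclotomic (q : ℕ) ℂ ^ u q).rootMultiplicity ζ
        = if p = q then u q else 0 := fun q => by
      rw [rootMultiplicity_pow_of_ne_zero (cyclotomic_ne_zero q ℂ),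
        rootMultiplicity_cyclotomic (hS q q.2).1 hζ]
      simp [Subtype.ext_iff, eq_comm]
    simp [hq, eq_comm]
  -- Orders of P/Q may be negative, hence the passage to ℤ.
  have hstep : ∀ ζ : ℂ, IsPrimitiveRoot ζ p →
      ((P.rootMultiplicity (ζ ^ k) : ℤ) - Q.rootMultiplicity (ζ ^ k))
        = (P.rootMultiplicity ζ - Q.rootMultiplicity ζ) + ((s p : ℤ) - t p) := by
    intro ζ hζ
    have hζ0 : ζ ≠ 0 := hζ.ne_zero hp0.ne'
    have hPe := (expand_ne_zero hk).2 hP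
    have hQe := (expand_ne_zero hk).2 hQ
    have := congrArg (rootMultiplicity ζ) h
    rw [rootMultiplicity_mul (mul_ne_zero (mul_ne_zero hQ hPe) (hprod t)),
      rootMultiplicity_mul (mul_ne_zero hQ hPe),
      rootMultiplicity_mul (mul_ne_zero (mul_ne_zero hP hQe) (hprod s)),
      rootMultiplicity_mul (mul_ne_zero hP hQe), hmult s ζ hζ, hmult t ζ hζ,
      rootMultiplicity_expand_of_charZero hk hζ0 hP,
      rootMultiplicity_expand_of_charZero hk hζ0 hQ] at this
    lia
  set ζ : ℂ := Complex.exp (2 * Real.pi * Complex.I / (p : ℕ))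
  have hζ : IsPrimitiveRoot ζ p := Complex.isPrimitiveRoot_exp _ hp0.ne'
  have hiter : ∀ n : ℕ,
      ((P.rootMultiplicity (ζ ^ k ^ n) : ℤ) - Q.rootMultiplicity (ζ ^ k ^ n))
        = (P.rootMultiplicity ζ - Q.rootMultiplicity ζ) + n * ((s p : ℤ) - t p) := by
    intro n
    induction n with
    | zero => simp
    | succ n ih =>
      have := hstep (ζ ^ k ^ n) (hζ.pow_of_coprime _ (hpk.symm.pow_left n))
      rw [← pow_mul, ← pow_succ, ih] at this
      rw [this]
      push_cast
      ring
  -- By Euler's theorem the orbit closes up, so the accumulated change `φ(p) * (s p - t p)` is zero.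
  have hcycle : ζ ^ k ^ Nat.totient p = ζ := by
    have hmod := Nat.ModEq.pow_totient hpk.symm
    have := pow_eq_pow_mod (k ^ Nat.totient p) hζ.pow_eq_one
    rw [this, hmod, ← pow_eq_pow_mod 1 hζ.pow_eq_one, pow_one]
  have hfin := hiter (Nat.totient p)
  rw [hcycle, left_eq_add, mul_eq_zero] at hfin
  have hpos := Nat.totient_pos.2 hp0
  lia

/-! ### Functions given on the unit disc by power series -/

/-- `f` is the sum of the power series `T` on the open unit disc. -/
def HasDiscSum (f : ℂ → ℂ) (T : PowerSeries ℂ) : Prop :=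
  ∀ z : ℂ, ‖z‖ < 1 → HasSum (fun m => PowerSeries.coeff m T * z ^ m) (f z)

theorem hasDiscSum_taylorSeriesAtZero {f : ℂ → ℂ}
    (hf : DifferentiableOn ℂ f (Metric.ball 0 1)) : HasDiscSum f (taylorSeriesAtZero f) := by
  intro z hz
  have hterm : (fun m => PowerSeries.coeff m (taylorSeriesAtZero f) * z ^ m)
      = fun m : ℕ => (m.factorial : ℂ)⁻¹ • (z - 0) ^ m • iteratedDeriv m f 0 := by
    funext m
    have hm : PowerSeries.coeff m (taylorSeriesAtZero f) = iteratedDeriv m f 0 / m.factorial :=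
      PowerSeries.coeff_mk _ _
    rw [hm, sub_zero, smul_eq_mul, smul_eq_mul]
    ring
  rw [hterm]
  exact Complex.hasSum_taylorSeries_on_ball hf (mem_ball_zero_iff.2 hz)

namespace HasDiscSum

/-- Turns identities between functions on the disc into identities between formal series. -/
theorem unique {f : ℂ → ℂ} {T U : PowerSeries ℂ} (hT : HasDiscSum f T) (hU : HasDiscSum f U) :
    T = U := by
  have key : ∀ {V : PowerSeries ℂ}, HasDiscSum f V → HasFPowerSeriesAt f
      (FormalMultilinearSeries.ofScalars ℂ fun m => PowerSeries.coeff m V) 0 := by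
    intro V hV
    rw [hasFPowerSeriesAt_iff]
    filter_upwards [Metric.ball_mem_nhds (0 : ℂ) one_pos] with z hz
    simpa [mul_comm] using hV z (by simpa using hz)
  ext m
  have := congrArg (fun q => q.coeff m) ((key hT).eq_formalMultilinearSeries (key hU))
  simpa using this

theorem mul {f g : ℂ → ℂ} {T U : PowerSeries ℂ} (hT : HasDiscSum f T) (hU : HasDiscSum g U) :
    HasDiscSum (fun z => f z * g z) (T * U) := by
  intro z hz
  have hTn := (hT z hz).summable.norm
  have hUn := (hU z hz).summable.norm
  have hcoeff : ∀ m, PowerSeries.coeff m (T * U) * z ^ m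
      = ∑ x ∈ Finset.HasAntidiagonal.antidiagonal m,
        (PowerSeries.coeff x.1 T * z ^ x.1) * (PowerSeries.coeff x.2 U * z ^ x.2) := by
    intro m
    rw [PowerSeries.coeff_mul, Finset.sum_mul]
    refine Finset.sum_congr rfl fun x hx => ?_
    rw [← Finset.HasAntidiagonal.mem_antidiagonal.1 hx, pow_add]
    ring
  simp only [hcoeff]
  rw [← (hT z hz).tsum_eq, ← (hU z hz).tsum_eq,
    tsum_mul_tsum_eq_tsum_sum_antidiagonal_of_summable_norm hTn hUn]
  exact (summable_norm_sum_mul_antidiagonal_of_summable_norm hTn hUn).of_norm.hasSum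

theorem polynomial (P : ℂ[X]) : HasDiscSum (fun z => P.eval z) (P : PowerSeries ℂ) := by
  intro z _
  have : P.eval z = ∑ m ∈ P.support, PowerSeries.coeff m (P : PowerSeries ℂ) * z ^ m := by
    simp [eval_eq_sum, Polynomial.sum]
  simp only [this]
  refine hasSum_sum_of_ne_finset_zero fun m hm => ?_
  simp [notMem_support_iff.1 hm]

theorem expand {f : ℂ → ℂ} {T : PowerSeries ℂ} (hT : HasDiscSum f T) {k : ℕ} (hk : k ≠ 0) :
    HasDiscSum (fun z => f (z ^ k)) (PowerSeries.expand k hk T) := by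
  intro z hz
  have hinj : Function.Injective fun m : ℕ => k * m := mul_right_injective₀ hk
  refine (hinj.hasSum_iff fun m hm => ?_).1 ?_
  · rw [PowerSeries.coeff_expand_of_not_dvd, zero_mul]
    rintro ⟨n, rfl⟩
    exact hm ⟨n, rfl⟩
  · have := hT (z ^ k) (by rw [norm_pow]; exact pow_lt_one₀ (norm_nonneg z) hz hk)
    simpa [Function.comp_def, PowerSeries.coeff_expand_mul, pow_mul] using this

end HasDiscSum

/-! ### The products of cyclotomic polynomials -/

/-- From Φ_p(w) = 1 + w + ⋯ + w^(p-1); this feeds the M-test for the infinite product. -/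
theorem norm_cyclotomic_prime_eval_sub_one_le {p : ℕ} (hp : p.Prime) {w : ℂ} (hw : ‖w‖ ≤ 1) :
    ‖(cyclotomic p ℂ).eval w - 1‖ ≤ p * ‖w‖ := by
  have : Fact p.Prime := ⟨hp⟩
  obtain ⟨q, rfl⟩ := Nat.exists_eq_succ_of_ne_zero hp.ne_zero
  rw [cyclotomic_prime, eval_geom_sum, Finset.sum_range_succ', pow_zero, add_sub_cancel_right]
  calc ‖∑ i ∈ Finset.range q, w ^ (i + 1)‖
      ≤ ∑ i ∈ Finset.range q, ‖w‖ := norm_sum_le_of_le _ fun i _ => by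
        rw [norm_pow, pow_succ]
        exact mul_le_of_le_one_left (norm_nonneg w) (pow_le_one₀ (norm_nonneg w) hw)
    _ ≤ (q.succ : ℕ) * ‖w‖ := by
        rw [Finset.sum_const, Finset.card_range, nsmul_eq_mul]
        gcongr
        simp

theorem cyclotomicProduct_hasProdLocallyUniformlyOn {k p : ℕ} (hk : 2 ≤ k) (hp : p.Prime) :
    HasProdLocallyUniformlyOn (fun n z => (cyclotomic p ℂ).eval (z ^ (k ^ n)))
      (cyclotomicProduct k p) (Metric.ball 0 1) := by
  have hform : (fun (n : ℕ) (z : ℂ) => (cyclotomic p ℂ).eval (z ^ (k ^ n)))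
      = fun n z => 1 + ((cyclotomic p ℂ).eval (z ^ (k ^ n)) - 1) := by
    simp
  have hlim : cyclotomicProduct k p
      = fun z => ∏' n : ℕ, (1 + ((cyclotomic p ℂ).eval (z ^ (k ^ n)) - 1)) := by
    simp [cyclotomicProduct, funext_iff]
  rw [hform, hlim]
  refine hasProdLocallyUniformlyOn_of_forall_compact Metric.isOpen_ball fun K hK hcK => ?_
  obtain ⟨r, hr0, hr1, hr⟩ : ∃ r : ℝ, 0 ≤ r ∧ r < 1 ∧ ∀ z ∈ K, ‖z‖ ≤ r := by
    rcases K.eq_empty_or_nonempty with rfl | hne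
    · exact ⟨0, le_rfl, one_pos, by simp⟩
    · obtain ⟨z₀, hz₀, hmax⟩ := hcK.exists_isMaxOn hne continuous_norm.continuousOn
      exact ⟨‖z₀‖, norm_nonneg _, by simpa using hK hz₀, fun z hz => hmax hz⟩
  refine ((summable_geometric_of_lt_one hr0 hr1).mul_left (p : ℝ)).hasProdUniformlyOn_nat_one_add
    hcK (.of_forall fun n z hz => ?_) fun n => by fun_prop
  have hz1 : ‖z‖ ≤ 1 := (hr z hz).trans hr1.le
  refine (norm_cyclotomic_prime_eval_sub_one_le hp
    (by rw [norm_pow]; exact pow_le_one₀ (norm_nonneg z) hz1)).trans ?_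
  gcongr
  rw [norm_pow]
  -- Since n ≤ k^n, the lacunary powers are dominated by the geometric series in r.
  exact (pow_le_pow_of_le_one (norm_nonneg z) hz1 (Nat.lt_pow_self hk).le).trans
    (pow_le_pow_left₀ (norm_nonneg z) (hr z hz) n)

theorem multipliable_cyclotomic_eval_pow {k p : ℕ} (hk : 2 ≤ k) (hp : p.Prime) {z : ℂ}
    (hz : ‖z‖ < 1) : Multipliable fun n : ℕ => (cyclotomic p ℂ).eval (z ^ (k ^ n)) :=
  ((cyclotomicProduct_hasProdLocallyUniformlyOn hk hp).hasProd
    (mem_ball_zero_iff.2 hz)).multipliable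

theorem hasDiscSum_cyclotomicProduct {k p : ℕ} (hk : 2 ≤ k) (hp : p.Prime) :
    HasDiscSum (cyclotomicProduct k p) (taylorSeriesAtZero (cyclotomicProduct k p)) :=
  hasDiscSum_taylorSeriesAtZero <|
    (cyclotomicProduct_hasProdLocallyUniformlyOn hk hp).differentiableOn
      (.of_forall fun _ => by
        simpa [Finset.prod_fn] using DifferentiableOn.finsetProd fun _ _ => by fun_prop)
      Metric.isOpen_ball

theorem cyclotomicProduct_eq_mul {k p : ℕ} (hk : 2 ≤ k) (hp : p.Prime) {z : ℂ} (hz : ‖z‖ < 1) :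
    cyclotomicProduct k p z = (cyclotomic p ℂ).eval z * cyclotomicProduct k p (z ^ k) := by
  have hzk : ‖z ^ k‖ < 1 := by
    rw [norm_pow]; exact pow_lt_one₀ (norm_nonneg z) hz (by lia)
  have hsucc : (fun n : ℕ => (cyclotomic p ℂ).eval ((z ^ k) ^ (k ^ n)))
      = fun n : ℕ => (cyclotomic p ℂ).eval (z ^ (k ^ (n + 1))) := by
    funext n
    rw [← pow_mul, pow_succ']
  have hmul := multipliable_cyclotomic_eval_pow hk hp hzk
  rw [hsucc] at hmul
  rw [cyclotomicProduct,
    tprod_eq_zero_mul' (f := fun n : ℕ => (cyclotomic p ℂ).eval (z ^ (k ^ n))) hmul,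
    cyclotomicProduct, hsucc, pow_zero, pow_one]

/-- The functional equation of the Taylor series of `F_p`. -/
theorem taylorSeriesAtZero_cyclotomicProduct_eq {k p : ℕ} (hk : 2 ≤ k) (hk0 : k ≠ 0)
    (hp : p.Prime) :
    taylorSeriesAtZero (cyclotomicProduct k p) = (cyclotomic p ℂ : PowerSeries ℂ)
      * PowerSeries.expand k hk0 (taylorSeriesAtZero (cyclotomicProduct k p)) := by
  have hF := hasDiscSum_cyclotomicProduct hk hp
  refine hF.unique fun z hz => ?_
  rw [cyclotomicProduct_eq_mul hk hp hz]
  exact (HasDiscSum.polynomial (cyclotomic p ℂ)).mul (hF.expand hk0) z hz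

/-- The constant term is 1, because Φ_p(0) = 1. -/
theorem taylorSeriesAtZero_cyclotomicProduct_ne_zero {k p : ℕ} (hk : 2 ≤ k) (hp : p.Prime) :
    taylorSeriesAtZero (cyclotomicProduct k p) ≠ 0 := by
  intro h
  have h0 := congrArg (PowerSeries.coeff 0) h
  have hone : (cyclotomic p ℂ).eval 0 = 1 := by
    rw [← coeff_zero_eq_eval_zero, cyclotomic_coeff_zero ℂ hp.one_lt]
  have hk0 : k ≠ 0 := by lia
  simp [taylorSeriesAtZero, cyclotomicProduct, hk0, hone] at h0

/-! ### Algebraic independence -/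

theorem Polynomial.coe_expand_powerSeries {R : Type*} [CommRing R] {k : ℕ} (hk : k ≠ 0)
    (P : R[X]) : ((Polynomial.expand R k P : R[X]) : PowerSeries R)
      = PowerSeries.expand k hk (P : PowerSeries R) := by
  induction P using Polynomial.induction_on' with
  | add P Q hP hQ => simp [hP, hQ]
  | monomial n a => simp [mul_comm]

/-- The substitution `X ↦ X ^ k` on power series, semilinear over the same substitution on
polynomials. -/
noncomputable def PowerSeries.expandSemilinear (R : Type*) [CommRing R] (k : ℕ) (hk : k ≠ 0) :
    PowerSeries R →ₛₗ[(Polynomial.expand R k).toRingHom] PowerSeries R where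
  toFun := PowerSeries.expand k hk
  map_add' := map_add _
  map_smul' P f := by
    simp [Algebra.smul_def, PowerSeries.algebraMap_apply', coe_expand_powerSeries hk]

theorem linearIndependent_cyclotomicProduct_monomials {k : ℕ} (hk : 2 ≤ k) :
    LinearIndependent ℂ[X] fun s : {p : ℕ // p.Prime ∧ Odd p ∧ p.Coprime k} →₀ ℕ =>
      s.prod fun p e => taylorSeriesAtZero (cyclotomicProduct k p) ^ e := by
  have hk0 : k ≠ 0 := by lia
  have : Module.IsTorsionFree ℂ[X] (PowerSeries ℂ) :=
    Module.isTorsionFree_iff_algebraMap_injective.2 (coe_injective ℂ)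
  refine linearIndependent_of_eq_smul_semilinear
    (a := fun s => s.prod fun p e => cyclotomic (p : ℕ) ℂ ^ e)
    (PowerSeries.expandSemilinear ℂ k hk0)
    (fun s => ?_) (fun s => ?_) (fun s => ?_) fun s t P Q hP hQ h => ?_
  · exact Finset.prod_ne_zero_iff.2 fun p _ =>
      pow_ne_zero _ (taylorSeriesAtZero_cyclotomicProduct_ne_zero hk p.2.1)
  · exact Finset.prod_ne_zero_iff.2 fun p _ => pow_ne_zero _ (cyclotomic_ne_zero p ℂ)
  · change _ = _ • PowerSeries.expand k hk0 _
    rw [Algebra.smul_def, Finsupp.prod, Finsupp.prod, map_prod, map_prod,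
      ← Finset.prod_mul_distrib]
    refine Finset.prod_congr rfl fun p _ => ?_
    rw [map_pow, map_pow, ← mul_pow]
    congr 1
    exact taylorSeriesAtZero_cyclotomicProduct_eq hk hk0 p.2.1
  · exact eq_of_cyclotomic_prod_mul_expand (Nat.pos_of_ne_zero hk0)
      (fun p hp => ⟨hp.1.pos, hp.2.2⟩) s t hP hQ h

theorem algebraicIndependent_of_linearIndependent_monomials {ι R A : Type*} [CommRing R]
    [CommRing A] [Algebra R A] {x : ι → A}
    (h : LinearIndependent R fun s : ι →₀ ℕ => s.prod fun i e => x i ^ e) :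
    AlgebraicIndependent R x := by
  rw [algebraicIndependent_iff]
  intro P hP
  rw [linearIndependent_iff] at h
  refine AddMonoidAlgebra.coeff_injective (h (AddMonoidAlgebra.coeff P) ?_)
  rw [← hP, MvPolynomial.aeval_def, MvPolynomial.eval₂_eq, Finsupp.linearCombination_apply,
    Finsupp.sum]
  exact Finset.sum_congr rfl fun s _ => Algebra.smul_def _ _

theorem algebraicIndependent_cyclotomicProductSeries {k : ℕ} (hk : 2 ≤ k) :
    AlgebraicIndependent (RatFunc ℂ)
      (fun p : {p : ℕ // p.Prime ∧ Odd p ∧ p.Coprime k} => cyclotomicProductSeries k p) := by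
  refine algebraicIndependent_of_linearIndependent_monomials ?_
  -- Clearing denominators reduces ℂ(z) to ℂ[z], where the relation can be pulled back to power
  -- series.
  rw [← LinearIndependent.iff_fractionRing ℂ[X] (RatFunc ℂ)]
  have : IsScalarTower ℂ[X] (PowerSeries ℂ) (LaurentSeries ℂ) := .of_algebraMap_eq fun _ => rfl
  have hinj : Function.Injective
      (IsScalarTower.toAlgHom ℂ[X] (PowerSeries ℂ) (LaurentSeries ℂ)).toLinearMap :=
    HahnSeries.ofPowerSeries_injective
  have hmap : (fun s : {p : ℕ // p.Prime ∧ Odd p ∧ p.Coprime k} →₀ ℕ =>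
        s.prod fun p e => cyclotomicProductSeries k p ^ e)
      = (IsScalarTower.toAlgHom ℂ[X] (PowerSeries ℂ) (LaurentSeries ℂ)).toLinearMap ∘
        fun s => s.prod fun p e => taylorSeriesAtZero (cyclotomicProduct k p) ^ e := by
    funext s
    simp [cyclotomicProductSeries, Finsupp.prod]
  rw [hmap]
  exact (linearIndependent_cyclotomicProduct_monomials hk).map' _ (LinearMap.ker_eq_bot.2 hinj)

theorem mainTheorem6 (k : ℕ) (hk : 2 ≤ k) :
    (∀ p : ℕ, p.Prime → Odd p → p.Coprime k → ∀ z : ℂ, ‖z‖ < 1 →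
      Multipliable (fun n : ℕ => (Polynomial.cyclotomic p ℂ).eval (z ^ (k ^ n))) ∧
      HasSum
        (fun m : ℕ => PowerSeries.coeff m (taylorSeriesAtZero (cyclotomicProduct k p)) * z ^ m)
        (cyclotomicProduct k p z)) ∧
    AlgebraicIndependent (RatFunc ℂ)
      (fun p : {p : ℕ // p.Prime ∧ Odd p ∧ p.Coprime k} => cyclotomicProductSeries k p) :=
  ⟨fun _ hp _ _ z hz =>
    ⟨multipliable_cyclotomic_eval_pow hk hp hz, hasDiscSum_cyclotomicProduct hk hp z hz⟩,
    algebraicIndependent_cyclotomicProductSeries hk⟩
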